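/- Let $S=\bigoplus_{i\ge 0}S_i$ be a Noetherian $\mathbb{Z}_{\ge 0}$-graded commutative ring which contains $\mathbb{Q}$ and whose degree-zero part $S_0$ is a local ring. For $i\ge 0$ let $\Omega^i_{S/S_0}=\bigwedge^i_S\Omega^1_{S/S_0}$ be the $i$-th exterior power of the module of Kähler differentials, and for an $S$-module $M$ let $\operatorname{tr}_S(M)=\sum_{\varphi\in\operatorname{Hom}_S(M,S)}\varphi(M)$ be its trace ideal. A graded polynomial extension of a graded ring $T$ in $n$ variables is a polynomial ring $T[x_1,\dots,x_n]$ with a grading which extends that of $T$ and for which every $x_i$ is homogeneous of positive degree. The polynomial rank $\operatorname{p.rk}(S)$ is the supremum of the integers $n\ge 0$ such that $S$ is isomorphic, as a graded ring, to a graded polynomial extension $T[x_1,\dots,x_n]$ of some graded subring $T$ of $S$. Then the Krull dimension $\dim S$ is finite, and for every integer $k$ with $0\le k\le\dim S$, $$\operatorname{p.rk}(S)\ge\dim S-k\quad\Longleftrightarrow\quad\operatorname{tr}_S\bigl(\Omega^{\dim S-k}_{S/S_0}\bigr)=S.$$ In particular, the following are equivalent: (i) $S$ is isomorphic, as a graded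 ring, to a graded polynomial extension $A[x_1,\dots,x_n]$, for some $n\ge 0$, of a $\mathbb{Z}_{\ge 0}$-graded ring $A$ of Krull dimension $0$; (ii) $S$ is isomorphic, as a graded $S_0$-algebra, to a graded polynomial extension $A[x_1,\dots,x_n]$, for some $n\ge 0$, of a $\mathbb{Z}_{\ge 0}$-graded $S_0$-algebra $A$ of Krull dimension $0$; (iii) $\operatorname{tr}_S\bigl(\Omega^{\dim S}_{S/S_0}\bigr)=S$. -/

import Mathlib

open scoped ExteriorAlgebra

universe u v

/-- The trace ideal of an `R`-module `M`: the sum of the images of all `R`-linear maps `M → R`. -/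
def traceIdeal (R : Type u) [CommRing R] (M : Type v) [AddCommGroup M] [Module R M] : Ideal R :=
  ⨆ φ : M →ₗ[R] R, LinearMap.range φ

/-- The differentials `Ω^i_{S/S₀}`, the `i`-th exterior power over `S` of the Kähler
differentials of the graded ring `S` over its degree-zero part `S₀ = 𝒜 0`. -/
abbrev GradedDifferentials {S : Type u} [CommRing S] (𝒜 : ℕ → AddSubgroup S) [GradedRing 𝒜]
    (i : ℕ) : Type u :=
  ⋀[S]^i (KaehlerDifferential (𝒜 0) S)

/-- The grading of the polynomial ring `T[x_i : i ∈ ι]` over a graded ring `(T, ℬ)` which extends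
the grading of `T` and gives `x_i` the degree `w i`: a polynomial has degree `m` if every monomial
`c * x^e` occurring in it has a coefficient `c` that is homogeneous of some degree `j` with
`j + ∑ i, e i * w i = m`. -/
def polynomialGrading {T : Type u} [CommRing T] {σ : Type*} [SetLike σ T] [AddSubgroupClass σ T]
    (ℬ : ℕ → σ) {ι : Type*} (w : ι → ℕ) (m : ℕ) : AddSubgroup (MvPolynomial ι T) where
  carrier := {p | ∀ e : ι →₀ ℕ, p.coeff e ≠ 0 →
    ∃ j : ℕ, j + Finsupp.weight w e = m ∧ p.coeff e ∈ ℬ j}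
  zero_mem' := fun e he => absurd (MvPolynomial.coeff_zero e) he
  add_mem' := by
    intro p q hp hq e he
    by_cases h1 : p.coeff e = 0
    · have h2 : q.coeff e ≠ 0 := fun h2 => he (by simp [h1, h2])
      simpa [h1] using hq e h2
    · by_cases h2 : q.coeff e = 0
      · simpa [h2] using hp e h1
      · obtain ⟨j, hj, hpj⟩ := hp e h1
        obtain ⟨l, hl, hql⟩ := hq e h2
        obtain rfl : j = l := by omega
        exact ⟨j, hj, by simpa using add_mem hpj hql⟩
  neg_mem' := by
    intro p hp e he
    obtain ⟨j, hj, hpj⟩ := hp e (fun h => he (by simp [h]))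
    exact ⟨j, hj, by simpa using neg_mem hpj⟩

/-- The grading of a homogeneous subring `T` of a graded ring `(S, 𝒜)`. -/
def subringGrading {S : Type u} [CommRing S] (𝒜 : ℕ → AddSubgroup S) (T : Subring S) (i : ℕ) :
    AddSubgroup T :=
  (𝒜 i).comap T.subtype.toAddMonoidHom

/-- `(S, 𝒜)` is isomorphic, as a graded ring, to a graded polynomial extension
`T[x_1, …, x_n]` of some graded subring `T` of `S`; the variables are homogeneous of positive
degrees `w 1, …, w n`. -/
def IsPolynomialExtension {S : Type u} [CommRing S] (𝒜 : ℕ → AddSubgroup S) [GradedRing 𝒜]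
    (n : ℕ) : Prop :=
  ∃ (T : Subring S) (_ : DirectSum.SetLike.IsHomogeneous 𝒜 T) (w : Fin n → ℕ) (_ : ∀ i, 0 < w i)
    (e : S ≃+* MvPolynomial (Fin n) T),
    ∀ (m : ℕ) (s : S), e s ∈ polynomialGrading (subringGrading 𝒜 T) w m ↔ s ∈ 𝒜 m

/-- The polynomial rank of a graded ring: the supremum of the `n` such that the ring is a graded
polynomial extension in `n` variables of a graded subring. -/
noncomputable def polynomialRank {S : Type u} [CommRing S] (𝒜 : ℕ → AddSubgroup S)
    [GradedRing 𝒜] : ℕ∞ :=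
  ⨆ (n : ℕ) (_ : IsPolynomialExtension 𝒜 n), (n : ℕ∞)

/-- `(S, 𝒜)` is isomorphic, as a graded ring, to a graded polynomial ring `A[x_1, …, x_n]` over a
graded ring `A` of Krull dimension zero. -/
def IsPolynomialOverDimZero {S : Type u} [CommRing S] (𝒜 : ℕ → AddSubgroup S)
    [GradedRing 𝒜] : Prop :=
  ∃ (A : Type u) (_ : CommRing A) (ℬ : ℕ → AddSubgroup A) (_ : GradedRing ℬ)
    (_ : ringKrullDim A = 0) (n : ℕ) (w : Fin n → ℕ) (_ : ∀ i, 0 < w i)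
    (e : S ≃+* MvPolynomial (Fin n) A),
    ∀ (m : ℕ) (s : S), e s ∈ polynomialGrading ℬ w m ↔ s ∈ 𝒜 m

/-- `(S, 𝒜)` is isomorphic, as a graded algebra over `S₀ = 𝒜 0`, to a graded polynomial ring
`A[x_1, …, x_n]` over a graded `S₀`-algebra `A` of Krull dimension zero. -/
def IsPolynomialOverDimZeroAlgebra {S : Type u} [CommRing S] (𝒜 : ℕ → AddSubgroup S)
    [GradedRing 𝒜] : Prop :=
  ∃ (A : Type u) (_ : CommRing A) (_ : Algebra (𝒜 0) A) (ℬ : ℕ → Submodule (𝒜 0) A)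
    (_ : GradedAlgebra ℬ) (_ : ringKrullDim A = 0) (n : ℕ) (w : Fin n → ℕ) (_ : ∀ i, 0 < w i)
    (e : S ≃ₐ[𝒜 0] MvPolynomial (Fin n) A),
    ∀ (m : ℕ) (s : S), e s ∈ polynomialGrading ℬ w m ↔ s ∈ 𝒜 m

/-!
A homogeneous derivation `D` of negative degree with a slice `x`, that is `D x = 1`, splits off a
polynomial variable: as `ℚ ⊆ S` and `D` lowers degrees, `S = T[x]` with `T = ker D`
(`eval₂_derivationConstants_injective`, `eval₂_derivationConstants_surjective`). Given homogeneous
elements `x_i` of positive degree and derivations `D_i` with `D_i x_j = δ_ij`, this can be repeated: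
the `x_j` with `j ≠ 0` are constants of `D_0`, and the other `D_i` induce derivations of `ker D_0` by
restriction and reduction modulo `x_0`. These may fail to be homogeneous, but one can always pass to
homogeneous components (`derivationComponent`) without losing duality. Hence such data make `S` a
graded polynomial extension with variables `x_i` (`exists_subring_bijective_eval₂Hom`,
`mem_polynomialGrading_iff`).

Such data exist in `n` variables exactly if the trace ideal of `Ω^n` is `S`. If the trace ideal is
`S`, locality of `S₀` provides a single map `φ : Ω^n → S` and homogeneous `x_i` such that
`φ (dx_1 ∧ ⋯ ∧ dx_n)` has a unit of `S₀` as component of degree zero; replacing one `dx_i` by `df`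
gives the `D_i` (`exists_dual_derivations_of_traceIdeal_eq_top`). Conversely, `det (D_i f_j)` is a
functional on `Ω^n` which takes the value `1` (`traceIdeal_eq_top_of_dual_derivations`), and in a
graded polynomial extension the partial derivatives are dual to the variables. They are `S₀`-linear
since variables have positive degree (`traceIdeal_eq_top_of_equiv`).

The statements on dimension then follow from `dim A[x_1, …, x_n] = dim A + n` for Noetherian `A`,
which also bounds `dim S`, since `S` is a finitely generated algebra over the Noetherian local ring
`S₀` (`finiteType_gradeZero`).
-/

/-! ### Homogeneous subrings -/

section Grading

variable {S : Type u} [CommRing S] (𝒜 : ℕ → AddSubgroup S) [GradedRing 𝒜]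

theorem coe_decompose_coeAddMonoidHom_subringGrading (T : Subring S)
    (t : DirectSum ℕ fun i => subringGrading 𝒜 T i) (i : ℕ) :
    (DirectSum.decompose 𝒜
      ((DirectSum.coeAddMonoidHom (subringGrading 𝒜 T) t : T) : S) i : S) = ((t i : T) : S) := by
  induction t using DirectSum.induction_on with
  | zero => simp
  | of j a =>
    rw [DirectSum.coeAddMonoidHom_of]
    have ha : ((a : T) : S) ∈ 𝒜 j := a.2
    rw [DirectSum.decompose_of_mem 𝒜 ha]
    by_cases h : j = i
    · subst h; simp
    · rw [DirectSum.of_eq_of_ne _ _ _ (Ne.symm h), DirectSum.of_eq_of_ne _ _ _ (Ne.symm h)]; simp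
  | add a b ha hb => simp [ha, hb]

/-- A homogeneous subring of a graded ring is graded by its homogeneous elements. -/
@[reducible]
noncomputable def subringGradedRing {T : Subring S}
    (hT : DirectSum.SetLike.IsHomogeneous 𝒜 T) : GradedRing (subringGrading 𝒜 T) :=
  { one_mem := SetLike.GradedOne.one_mem (A := 𝒜)
    mul_mem := fun _ _ _ _ ha hb => SetLike.GradedMul.mul_mem (A := 𝒜) ha hb
    toDecomposition := by
      refine DirectSum.IsInternal.chooseDecomposition _ ⟨?_, ?_⟩
      · intro a b hab
        refine DFinsupp.ext fun i => ?_
        apply Subtype.ext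
        apply Subtype.ext
        erw [← coe_decompose_coeAddMonoidHom_subringGrading 𝒜 T a i,
          ← coe_decompose_coeAddMonoidHom_subringGrading 𝒜 T b i, hab]
      · intro t
        classical
        refine ⟨∑ i ∈ (DirectSum.decompose 𝒜 (t : S)).support,
          DirectSum.of (fun i => subringGrading 𝒜 T i) i
            ⟨⟨DirectSum.decompose 𝒜 (t : S) i, hT i t.2⟩, (DirectSum.decompose 𝒜 (t : S) i).2⟩, ?_⟩
        rw [map_sum]
        apply Subtype.ext
        simp only [DirectSum.coeAddMonoidHom_of, AddSubmonoidClass.coe_finsetSum]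
        exact DirectSum.sum_support_decompose 𝒜 (t : S) }

theorem coe_decompose_subringGrading {T : Subring S} [GradedRing (subringGrading 𝒜 T)]
    (t : T) (i : ℕ) :
    ((DirectSum.decompose (subringGrading 𝒜 T) t i : T) : S) =
      DirectSum.decompose 𝒜 (t : S) i := by
  rw [← coe_decompose_coeAddMonoidHom_subringGrading]
  congr 3
  exact congrArg Subtype.val ((DirectSum.decompose (subringGrading 𝒜 T)).left_inv t)

theorem isHomogeneous_map_subtype {T : Subring S} [GradedRing (subringGrading 𝒜 T)]
    {U : Subring T} (hU : DirectSum.SetLike.IsHomogeneous (subringGrading 𝒜 T) U) :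
    DirectSum.SetLike.IsHomogeneous 𝒜 (U.map T.subtype) := by
  rintro i _ ⟨u, hu, rfl⟩
  exact ⟨_, hU i hu, coe_decompose_subringGrading 𝒜 u i⟩

/-! ### Graded polynomial extensions inside a graded ring -/

theorem prod_pow_mem {ι : Type*} {x : ι → S} {w : ι → ℕ} (hx : ∀ i, x i ∈ 𝒜 (w i))
    (e : ι →₀ ℕ) : (e.prod fun i k => x i ^ k) ∈ 𝒜 (Finsupp.weight w e) := by
  rw [Finsupp.weight_apply]
  exact SetLike.prod_pow_mem_graded 𝒜 w x e fun i _ => hx i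

/-- If `S = T[x_i]` for a homogeneous subring `T` and algebraically independent homogeneous `x_i`,
then the grading of `S` is the one which the polynomial ring inherits from `T`. -/
theorem mem_polynomialGrading_iff {ι : Type*} {T : Subring S}
    (hT : DirectSum.SetLike.IsHomogeneous 𝒜 T) {x : ι → S} {w : ι → ℕ}
    (hx : ∀ i, x i ∈ 𝒜 (w i))
    (hinj : Function.Injective (MvPolynomial.eval₂Hom T.subtype x))
    (p : MvPolynomial ι T) (m : ℕ) :
    p ∈ polynomialGrading (subringGrading 𝒜 T) w m ↔
      MvPolynomial.eval₂Hom T.subtype x p ∈ 𝒜 m := by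
  classical
  constructor
  · intro hp
    rw [MvPolynomial.coe_eval₂Hom, MvPolynomial.eval₂_eq]
    refine sum_mem fun e he => ?_
    obtain ⟨j, rfl, hj⟩ := hp e (MvPolynomial.mem_support_iff.1 he)
    exact SetLike.GradedMul.mul_mem hj (prod_pow_mem 𝒜 hx e)
  · intro hp
    -- the degree `m` part of `∑ c_e x^e` is `∑ (c_e)_{m - |e|} x^e`
    let c : (ι →₀ ℕ) → T := fun e =>
      if Finsupp.weight w e ≤ m then
        ⟨DirectSum.decompose 𝒜 ((p.coeff e : T) : S) (m - Finsupp.weight w e), hT _ (p.coeff e).2⟩ else 0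
    let q : MvPolynomial ι T := ∑ e ∈ p.support, MvPolynomial.monomial e (c e)
    have hpq : p = q := by
      apply hinj
      rw [← DirectSum.decompose_of_mem_same 𝒜 hp]
      rw [MvPolynomial.coe_eval₂Hom, MvPolynomial.eval₂_eq, DirectSum.decompose_sum,
        DFinsupp.finsetSum_apply, AddSubmonoidClass.coe_finsetSum, ← MvPolynomial.coe_eval₂Hom,
        map_sum]
      refine Finset.sum_congr rfl fun e _ => ?_
      have := DirectSum.coe_decompose_mul_of_right_mem (𝒜 := 𝒜) (a := ((p.coeff e : T) : S)) m
        (prod_pow_mem 𝒜 hx e)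
      rw [MvPolynomial.coe_eval₂Hom, MvPolynomial.eval₂_monomial]
      refine this.trans ?_
      simp only [c]
      split_ifs <;> simp
    have hc : ∀ e, q.coeff e = 0 ∨ q.coeff e = c e := by
      intro e
      simp only [q, MvPolynomial.coeff_sum, MvPolynomial.coeff_monomial, Finset.sum_ite_eq']
      split_ifs <;> simp
    intro e he
    rw [hpq] at he ⊢
    have hce := (hc e).resolve_left he
    rw [hce] at he ⊢
    by_cases h : Finsupp.weight w e ≤ m
    · refine ⟨m - Finsupp.weight w e, by omega, ?_⟩
      simp only [c, if_pos h]
      exact (DirectSum.decompose 𝒜 ((p.coeff e : T) : S) _).2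
    · exact absurd (by simp only [c, if_neg h]) he

/-! ### Homogeneous components of derivations -/

/-- The homogeneous component of degree `-w` of a derivation `D`: it sends a homogeneous `s` of
degree `m` to the component of `D s` of degree `m - w`, and to `0` if `m < w`. -/
noncomputable def derivationComponent (D : Derivation ℤ S S) (w : ℕ) : Derivation ℤ S S :=
  let f : S →+ S :=
    (DirectSum.toAddMonoid fun m => if w ≤ m then
      (GradedRing.proj 𝒜 (m - w)).comp ((D : S →ₗ[ℤ] S).toAddMonoidHom.comp (𝒜 m).subtype)
      else 0).comp (DirectSum.decomposeAddEquiv 𝒜 : S →+ _)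
  have hf : ∀ m (s : 𝒜 m), f s = if w ≤ m then (DirectSum.decompose 𝒜 (D s) (m - w) : S) else 0 := by
    intro m s
    simp only [f, AddMonoidHom.comp_apply]
    erw [DirectSum.decompose_coe]
    rw [DirectSum.toAddMonoid_of]
    split_ifs <;> rfl
  Derivation.mk' f.toIntLinearMap fun a b => by
    change f (a * b) = a • f b + b • f a
    simp only [smul_eq_mul]
    induction a using DirectSum.Decomposition.inductionOn 𝒜 with
    | zero => simp
    | add a a' ha ha' => rw [add_mul, map_add, map_add, ha, ha']; ring
    | @homogeneous i a =>
      induction b using DirectSum.Decomposition.inductionOn 𝒜 with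
      | zero => simp
      | add b b' hb hb' => rw [mul_add, map_add, map_add, hb, hb']; ring
      | @homogeneous j b =>
        have h1 := hf (i + j) ⟨a * b, SetLike.GradedMul.mul_mem a.2 b.2⟩
        simp only at h1
        rw [h1, hf i a, hf j b, D.leibniz]
        simp only [smul_eq_mul, DirectSum.decompose_add, DirectSum.add_apply,
          AddMemClass.coe_add, DirectSum.coe_decompose_mul_of_left_mem (𝒜 := 𝒜) _ a.2,
          DirectSum.coe_decompose_mul_of_left_mem (𝒜 := 𝒜) _ b.2]
        by_cases hi : w ≤ i <;> by_cases hj : w ≤ j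
        · rw [if_pos (by omega), if_pos (by omega), if_pos (by omega), if_pos hi, if_pos hj,
            show i + j - w - i = j - w by omega, show i + j - w - j = i - w by omega]
        · rw [if_pos (by omega), if_neg (by omega), if_pos (by omega), if_pos hi, if_neg hj,
            show i + j - w - j = i - w by omega]; ring
        · rw [if_pos (by omega), if_pos (by omega), if_neg (by omega), if_neg hi, if_pos hj,
            show i + j - w - i = j - w by omega]; ring
        · rw [if_neg hi, if_neg hj]
          split_ifs
          · omega
          all_goals first | omega | simp

theorem derivationComponent_apply_of_mem (D : Derivation ℤ S S) (w : ℕ) {m : ℕ} {s : S}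
    (hs : s ∈ 𝒜 m) : derivationComponent 𝒜 D w s =
      if w ≤ m then (DirectSum.decompose 𝒜 (D s) (m - w) : S) else 0 := by
  lift s to 𝒜 m using hs
  change (DirectSum.toAddMonoid _ : _ →+ S) (DirectSum.decompose 𝒜 (s : S)) = _
  rw [DirectSum.decompose_coe, DirectSum.toAddMonoid_of]
  split_ifs <;> rfl

theorem derivationComponent_mem (D : Derivation ℤ S S) {w m : ℕ} {s : S}
    (hs : s ∈ 𝒜 (m + w)) : derivationComponent 𝒜 D w s ∈ 𝒜 m := by
  rw [derivationComponent_apply_of_mem 𝒜 D w hs, if_pos (by omega), Nat.add_sub_cancel]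
  exact SetLike.coe_mem _

theorem derivationComponent_eq_zero (D : Derivation ℤ S S) {w m : ℕ} {s : S}
    (hs : s ∈ 𝒜 m) (h : m < w) : derivationComponent 𝒜 D w s = 0 := by
  rw [derivationComponent_apply_of_mem 𝒜 D w hs, if_neg (by omega)]

theorem derivationComponent_apply_eq_one (D : Derivation ℤ S S) {w : ℕ} {x : S}
    (hx : x ∈ 𝒜 w) (h : D x = 1) : derivationComponent 𝒜 D w x = 1 := by
  rw [derivationComponent_apply_of_mem 𝒜 D w hx, if_pos le_rfl, h, Nat.sub_self,
    DirectSum.decompose_of_mem_same 𝒜 SetLike.GradedOne.one_mem]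

theorem derivationComponent_apply_eq_zero (D : Derivation ℤ S S) {w m : ℕ} {x : S}
    (hx : x ∈ 𝒜 m) (h : D x = 0) : derivationComponent 𝒜 D w x = 0 := by
  rw [derivationComponent_apply_of_mem 𝒜 D w hx, h]
  simp

theorem derivationComponent_decompose (D : Derivation ℤ S S) (w m : ℕ) (s : S) :
    derivationComponent 𝒜 D w (DirectSum.decompose 𝒜 s (m + w)) =
      DirectSum.decompose 𝒜 (derivationComponent 𝒜 D w s) m := by
  induction s using DirectSum.Decomposition.inductionOn 𝒜 with
  | zero => simp
  | add a b ha hb => simp [ha, hb]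
  | @homogeneous i a =>
    by_cases h : i = m + w
    · subst h
      rw [DirectSum.decompose_of_mem_same 𝒜 a.2,
        DirectSum.decompose_of_mem_same 𝒜 (derivationComponent_mem 𝒜 D a.2)]
    · rw [DirectSum.decompose_of_mem_ne 𝒜 a.2 h, map_zero]
      by_cases h' : i < w
      · rw [derivationComponent_eq_zero 𝒜 D a.2 h']; simp
      · have ha : (a : S) ∈ 𝒜 (i - w + w) := by rw [Nat.sub_add_cancel (by omega)]; exact a.2
        rw [DirectSum.decompose_of_mem_ne 𝒜 (derivationComponent_mem 𝒜 D ha) (by omega)]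

/-- The subring of constants of a derivation. -/
def derivationConstants (D : Derivation ℤ S S) : Subring S where
  carrier := {s | D s = 0}
  mul_mem' {a b} ha hb := by
    rw [Set.mem_ofPred_eq] at ha hb ⊢
    simp [ha, hb]
  one_mem' := D.map_one_eq_zero
  add_mem' {a b} ha hb := by
    rw [Set.mem_ofPred_eq] at ha hb ⊢
    simp [ha, hb]
  zero_mem' := map_zero D
  neg_mem' {a} ha := by
    rw [Set.mem_ofPred_eq] at ha ⊢
    simp [ha]

theorem mem_derivationConstants {S : Type u} [CommRing S] {D : Derivation ℤ S S} {s : S} :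
    s ∈ derivationConstants D ↔ D s = 0 := Iff.rfl

theorem isHomogeneous_derivationConstants (D : Derivation ℤ S S) (w : ℕ) :
    DirectSum.SetLike.IsHomogeneous 𝒜 (derivationConstants (derivationComponent 𝒜 D w)) := by
  intro i s hs
  rw [mem_derivationConstants] at hs ⊢
  by_cases h : i < w
  · exact derivationComponent_eq_zero 𝒜 D (SetLike.coe_mem _) h
  · obtain ⟨m, rfl⟩ : ∃ m, i = m + w := ⟨i - w, by omega⟩
    rw [derivationComponent_decompose, hs]
    simp

end Grading

/-! ### The slice theorem -/

section Slice

/-- Polynomials over a ring in which positive integers are invertible have antiderivatives. -/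
theorem exists_derivative_eq {T : Type u} [CommRing T] (hT : ∀ n : ℕ, n ≠ 0 → IsUnit (n : T))
    (p : Polynomial T) : ∃ q : Polynomial T, Polynomial.derivative q = p := by
  induction p using Polynomial.induction_on' with
  | add p q hp hq =>
    obtain ⟨p', rfl⟩ := hp
    obtain ⟨q', rfl⟩ := hq
    exact ⟨p' + q', by simp⟩
  | monomial n a =>
    obtain ⟨u, hu⟩ := hT (n + 1) (by omega)
    refine ⟨Polynomial.monomial (n + 1) (a * ↑u⁻¹), ?_⟩
    rw [Polynomial.derivative_monomial, ← hu, mul_assoc, Units.inv_mul, mul_one, Nat.add_sub_cancel]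

variable {S : Type u} [CommRing S]

theorem derivation_eval₂ (D : Derivation ℤ S S) {x : S} (hx : D x = 1)
    (p : Polynomial (derivationConstants D)) :
    D (p.eval₂ (derivationConstants D).subtype x) =
      (Polynomial.derivative p).eval₂ (derivationConstants D).subtype x := by
  induction p using Polynomial.induction_on' with
  | add p q hp hq => simp [Polynomial.eval₂_add, hp, hq]
  | monomial n a =>
    have ha : D (a : S) = 0 := a.2
    simp [Polynomial.derivative_monomial, Polynomial.eval₂_monomial, ha, hx, Derivation.leibniz_pow,
      mul_assoc]

theorem isUnit_natCast_derivationConstants (hS : ∀ n : ℕ, n ≠ 0 → IsUnit (n : S))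
    (D : Derivation ℤ S S) (n : ℕ) (hn : n ≠ 0) : IsUnit (n : derivationConstants D) := by
  obtain ⟨v, hv⟩ := (hS n hn).exists_right_inv
  have hDv : D v = 0 := by
    have h : D ((n : S) * v) = 0 := by rw [hv, D.map_one_eq_zero]
    rw [D.leibniz, D.map_natCast, smul_zero, add_zero, smul_eq_mul] at h
    exact (hS n hn).mul_right_eq_zero.1 h
  exact IsUnit.of_mul_eq_one ⟨v, hDv⟩ (Subtype.ext (by simpa using hv))

/-- A slice is transcendental over the constants: differentiating a relation in `x` yields a
relation of smaller degree. -/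
theorem eval₂_derivationConstants_injective (hS : ∀ n : ℕ, n ≠ 0 → IsUnit (n : S))
    (D : Derivation ℤ S S) {x : S} (hx : D x = 1) :
    Function.Injective (Polynomial.eval₂RingHom (derivationConstants D).subtype x) := by
  rw [injective_iff_map_eq_zero]
  have key : ∀ (n : ℕ) (p : Polynomial (derivationConstants D)), p.natDegree ≤ n →
      p.eval₂ (derivationConstants D).subtype x = 0 → p = 0 := by
    intro n
    induction n with
    | zero =>
      intro p hp h
      rw [Polynomial.eq_C_of_natDegree_le_zero hp] at h ⊢
      rw [Polynomial.eval₂_C] at h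
      rw [show p.coeff 0 = 0 from Subtype.ext h, Polynomial.C_0]
    | succ n ih =>
      intro p hp h
      have hd : Polynomial.derivative p = 0 := by
        refine ih _ ((Polynomial.natDegree_derivative_le p).trans (by omega)) ?_
        rw [← derivation_eval₂ D hx, h, map_zero]
      have hp0 : p = Polynomial.C (p.coeff 0) := by
        ext i : 1
        rcases i with _ | i
        · simp
        · have h' := congrArg (fun q => Polynomial.coeff q i) hd
          simp only [Polynomial.coeff_derivative, Polynomial.coeff_zero] at h'
          rw [Polynomial.coeff_C_succ]
          exact (isUnit_natCast_derivationConstants hS D (i + 1) (by omega)).mul_left_eq_zero.1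
            (by exact_mod_cast h')
      rw [hp0, Polynomial.eval₂_C] at h
      rw [hp0, show p.coeff 0 = 0 from Subtype.ext h, Polynomial.C_0]
  exact fun p => key _ p le_rfl

/-- Let `E` be the derivation, homogeneous of degree `-w`, and `x` a slice, `E x = 1`. Every
polynomial in `x` over the constants of `E` is `E q` for another such polynomial `q`. As `E` lowers
degrees, an induction on the degree of `s` makes `E s` such a polynomial, hence `E s = E q`, and
`s - q` is a constant. -/
theorem eval₂_derivationConstants_surjective (𝒜 : ℕ → AddSubgroup S) [GradedRing 𝒜]
    (hS : ∀ n : ℕ, n ≠ 0 → IsUnit (n : S)) (D : Derivation ℤ S S) {w : ℕ} (hw : 0 < w) {x : S}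
    (hx : derivationComponent 𝒜 D w x = 1) :
    Function.Surjective (Polynomial.eval₂RingHom
      (derivationConstants (derivationComponent 𝒜 D w)).subtype x) := by
  set E := derivationComponent 𝒜 D w with hE
  rw [← RingHom.range_eq_top, eq_top_iff]
  have key : ∀ (m : ℕ) (s : S), s ∈ 𝒜 m →
      s ∈ (Polynomial.eval₂RingHom (derivationConstants E).subtype x).range := by
    intro m
    induction m using Nat.strong_induction_on with
    | _ m ih =>
      intro s hs
      obtain ⟨p, hp⟩ : E s ∈ (Polynomial.eval₂RingHom (derivationConstants E).subtype x).range := by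
        by_cases h : m < w
        · rw [hE, derivationComponent_eq_zero 𝒜 D hs h]
          exact zero_mem _
        · refine ih (m - w) (by omega) _ (derivationComponent_mem 𝒜 D ?_)
          rwa [Nat.sub_add_cancel (by omega)]
      obtain ⟨q, rfl⟩ := exists_derivative_eq (isUnit_natCast_derivationConstants hS E) p
      rw [Polynomial.coe_eval₂RingHom, ← derivation_eval₂ E hx] at hp
      have hc : E (s - q.eval₂ (derivationConstants E).subtype x) = 0 := by
        rw [map_sub, hp, sub_self]
      refine ⟨Polynomial.C ⟨_, hc⟩ + q, ?_⟩
      rw [map_add, Polynomial.coe_eval₂RingHom, Polynomial.eval₂_C]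
      exact sub_add_cancel _ _
  intro s _
  induction s using DirectSum.Decomposition.inductionOn 𝒜 with
  | zero => exact zero_mem _
  | homogeneous a => exact key _ _ a.2
  | add a b ha hb => exact add_mem (ha trivial) (hb trivial)

end Slice

/-! ### Splitting off several variables -/

/-- Restriction of a derivation of `S` to a subring `T`, followed by a retraction `S → T`. -/
def derivationRetract {S : Type u} [CommRing S] {T : Subring S} (D : Derivation ℤ S S)
    (π : S →+* T) (hπ : ∀ t : T, π t = t) : Derivation ℤ T T :=
  Derivation.mk' (π.toAddMonoidHom.comp
      ((D : S →ₗ[ℤ] S).toAddMonoidHom.comp T.subtype.toAddMonoidHom)).toIntLinearMap fun a b => by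
    change π (D ((a : S) * b)) = a * π (D b) + b * π (D a)
    rw [D.leibniz, map_add, smul_eq_mul, smul_eq_mul, map_mul, map_mul, hπ, hπ]

theorem derivationRetract_apply {S : Type u} [CommRing S] {T : Subring S} (D : Derivation ℤ S S)
    (π : S →+* T) (hπ : ∀ t : T, π t = t) (t : T) :
    derivationRetract D π hπ t = π (D t) := rfl

/-- If `S = T₁[x_0]` and `T₁ = T[x_1, …, x_n]` then `S = T[x_0, …, x_n]`. -/
theorem bijective_eval₂Hom_of_tower {S : Type u} [CommRing S] {n : ℕ} (x : Fin (n + 1) → S)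
    {T₁ : Subring S} (h₁ : Function.Bijective (Polynomial.eval₂RingHom T₁.subtype (x 0)))
    (y : Fin n → T₁) (hy : ∀ i, (y i : S) = x i.succ) (T : Subring T₁)
    (hT : Function.Bijective (MvPolynomial.eval₂Hom T.subtype y)) :
    Function.Bijective (MvPolynomial.eval₂Hom (T.map T₁.subtype).subtype x) := by
  let g : T ≃+* T.map T₁.subtype :=
    T.equivMapOfInjective T₁.subtype Subtype.val_injective
  let E : MvPolynomial (Fin (n + 1)) (T.map T₁.subtype) ≃+* S :=
    ((MvPolynomial.finSuccEquiv _ n).toRingEquiv.trans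
      (Polynomial.mapEquiv ((MvPolynomial.mapEquiv (Fin n) g.symm).trans
        (RingEquiv.ofBijective _ hT)))).trans (RingEquiv.ofBijective _ h₁)
  have hE : MvPolynomial.eval₂Hom (T.map T₁.subtype).subtype x = (E : _ →+* S) := by
    refine MvPolynomial.ringHom_ext (fun t => ?_) fun i => ?_
    · obtain ⟨t, rfl⟩ := g.surjective t
      simp [E, MvPolynomial.finSuccEquiv_apply]
      rfl
    · refine Fin.cases ?_ (fun j => ?_) i
      · simp [E, MvPolynomial.finSuccEquiv_apply]
      · simp [E, MvPolynomial.finSuccEquiv_apply, hy]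
  rw [hE]
  exact E.bijective

/-- Homogeneous elements `x_i` of positive degree which are dual to derivations `D_i` are the
variables of a graded polynomial extension. The variables are split off one after the other: the
constants of the first derivation form a graded subring which contains the other `x_i`. -/
theorem exists_subring_bijective_eval₂Hom (n : ℕ) :
    ∀ {S : Type u} [CommRing S] (𝒜 : ℕ → AddSubgroup S) [GradedRing 𝒜]
      (_ : ∀ n : ℕ, n ≠ 0 → IsUnit (n : S)) (w : Fin n → ℕ) (_ : ∀ i, 0 < w i)
      (x : Fin n → S) (_ : ∀ i, x i ∈ 𝒜 (w i)) (D : Fin n → Derivation ℤ S S)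
      (_ : ∀ i, D i (x i) = 1) (_ : ∀ i j, i ≠ j → D i (x j) = 0),
      ∃ T : Subring S, DirectSum.SetLike.IsHomogeneous 𝒜 T ∧
        Function.Bijective (MvPolynomial.eval₂Hom T.subtype x) := by
  induction n with
  | zero =>
    intro S _ 𝒜 _ hS w hw x hx D h1 h0
    refine ⟨⊤, fun _ _ _ => trivial, ?_⟩
    have : MvPolynomial.eval₂Hom (⊤ : Subring S).subtype x =
        ((MvPolynomial.isEmptyRingEquiv (⊤ : Subring S) (Fin 0)).trans Subring.topEquiv : _ →+* S) := by
      refine MvPolynomial.ringHom_ext (fun t => ?_) fun i => i.elim0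
      simp only [RingHom.coe_coe, RingEquiv.trans_apply, MvPolynomial.eval₂Hom_C]
      exact congrArg Subtype.val (MvPolynomial.coeff_zero_C t).symm
    rw [this]
    exact RingEquiv.bijective _
  | succ n ih =>
    intro S _ 𝒜 _ hS w hw x hx D h1 h0
    set E := derivationComponent 𝒜 (D 0) (w 0) with hE
    have hE1 : E (x 0) = 1 := derivationComponent_apply_eq_one 𝒜 (D 0) (hx 0) (h1 0)
    have hbij : Function.Bijective
        (Polynomial.eval₂RingHom (derivationConstants E).subtype (x 0)) :=
      ⟨eval₂_derivationConstants_injective hS E hE1,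
        eval₂_derivationConstants_surjective 𝒜 hS (D 0) (hw 0) hE1⟩
    have hhom := isHomogeneous_derivationConstants 𝒜 (D 0) (w 0)
    rw [← hE] at hhom
    let _ := subringGradedRing 𝒜 hhom
    let e := RingEquiv.ofBijective _ hbij
    -- the retraction of `S = T₁[x_0]` onto `T₁` which sends `x_0` to `0`
    let π : S →+* derivationConstants E := (Polynomial.evalRingHom 0).comp (e.symm : S →+* _)
    have hπ : ∀ t : derivationConstants E, π t = t := by
      intro t
      have : e.symm (t : S) = Polynomial.C t := by
        rw [RingEquiv.symm_apply_eq]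
        simp [e]
      simp [π, this]
    let y : Fin n → derivationConstants E := fun i =>
      ⟨x i.succ, derivationComponent_apply_eq_zero 𝒜 (D 0) (hx _)
        (h0 0 i.succ (Fin.succ_ne_zero i).symm)⟩
    obtain ⟨T, hTh, hTb⟩ := ih (subringGrading 𝒜 (derivationConstants E))
      (isUnit_natCast_derivationConstants hS E) (fun i => w i.succ) (fun i => hw _) y
      (fun i => hx i.succ) (fun i => derivationRetract (D i.succ) π hπ)
      (fun i => by rw [derivationRetract_apply, h1, map_one])
      (fun i j hij => by
        rw [derivationRetract_apply, h0 _ _ fun h => hij (Fin.succ_injective _ h), map_zero])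
    exact ⟨T.map (derivationConstants E).subtype, isHomogeneous_map_subtype 𝒜 hTh,
      bijective_eval₂Hom_of_tower x hbij y (fun _ => rfl) T hTb⟩

/-! ### Trace ideals of exterior powers of the differentials -/

section Trace

variable {S : Type u} [CommRing S] (𝒜 : ℕ → AddSubgroup S) [GradedRing 𝒜]

theorem span_homogeneous_differentials :
    Submodule.span S {ω : KaehlerDifferential (𝒜 0) S |
      ∃ (m : ℕ) (y : S), y ∈ 𝒜 m ∧ KaehlerDifferential.D (𝒜 0) S y = ω} = ⊤ := by
  rw [eq_top_iff, ← KaehlerDifferential.span_range_derivation, Submodule.span_le]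
  rintro _ ⟨f, rfl⟩
  induction f using DirectSum.Decomposition.inductionOn 𝒜 with
  | zero => simp
  | add a b ha hb => rw [map_add]; exact add_mem ha hb
  | homogeneous a => exact Submodule.subset_span ⟨_, a, a.2, rfl⟩

theorem apply_mem_traceIdeal {R : Type u} [CommRing R] {M : Type v} [AddCommGroup M] [Module R M]
    (φ : M →ₗ[R] R) (m : M) : φ m ∈ traceIdeal R M :=
  (le_iSup (fun φ : M →ₗ[R] R => LinearMap.range φ) φ) ⟨m, rfl⟩

/-- Since `S₀` is local, a sum of values of maps `Ω^n → S` can only be `1` if a single value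
`φ (dy_1 ∧ ⋯ ∧ dy_n)` with homogeneous `y_i` has a unit as its component of degree zero. -/
theorem exists_isUnit_of_traceIdeal_eq_top [IsLocalRing (𝒜 0)] (n : ℕ)
    (h : traceIdeal S (GradedDifferentials 𝒜 n) = ⊤) :
    ∃ (φ : GradedDifferentials 𝒜 n →ₗ[S] S) (w : Fin n → ℕ) (y : Fin n → S),
      (∀ i, y i ∈ 𝒜 (w i)) ∧
      IsUnit (GradedRing.projZeroRingHom' 𝒜 (φ (exteriorPower.ιMulti S n
        fun i => KaehlerDifferential.D (𝒜 0) S (y i)))) := by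
  by_contra! hcon
  let I : Ideal S :=
    (IsLocalRing.maximalIdeal (𝒜 0)).comap (GradedRing.projZeroRingHom' 𝒜)
  have hI : traceIdeal S (GradedDifferentials 𝒜 n) ≤ I := by
    refine iSup_le fun φ => ?_
    rw [LinearMap.range_eq_map,
      ← exteriorPower.ιMulti_span_of_span S n _ (span_homogeneous_differentials 𝒜),
      Submodule.map_span_le]
    rintro _ ⟨a, ha, rfl⟩
    choose m y hy hya using fun i => ha (Set.mem_range_self i)
    rw [show a = fun i => KaehlerDifferential.D (𝒜 0) S (y i) from funext fun i => (hya i).symm]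
    exact (IsLocalRing.mem_maximalIdeal _).2 (hcon φ m y hy)
  rw [h, top_le_iff, Ideal.eq_top_iff_one] at hI
  have : (1 : 𝒜 0) ∈ IsLocalRing.maximalIdeal (𝒜 0) := by
    simpa only [I, Ideal.mem_comap, map_one] using hI
  exact (IsLocalRing.mem_maximalIdeal _).1 this isUnit_one

/-- If `φ (dx_1 ∧ ⋯ ∧ dx_n)` has a unit component in degree zero, then up to this unit
`f ↦ φ (dx_1 ∧ ⋯ ∧ df ∧ ⋯ ∧ dx_n)`, with `df` at the `i`-th place, is a
derivation whose homogeneous component of the right degree is dual to `x_i`. -/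
theorem exists_dual_derivations_of_traceIdeal_eq_top [IsLocalRing (𝒜 0)] (n : ℕ)
    (h : traceIdeal S (GradedDifferentials 𝒜 n) = ⊤) :
    ∃ (w : Fin n → ℕ) (x : Fin n → S) (D : Fin n → Derivation ℤ S S), (∀ i, 0 < w i) ∧
      (∀ i, x i ∈ 𝒜 (w i)) ∧ (∀ i, D i (x i) = 1) ∧ ∀ i j, i ≠ j → D i (x j) = 0 := by
  obtain ⟨φ, w, y, hy, u, hu⟩ := exists_isUnit_of_traceIdeal_eq_top 𝒜 n h
  have : Nontrivial S := (𝒜 0).subtype_injective.nontrivial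
  let d := KaehlerDifferential.D (𝒜 0) S
  let ψ (i : Fin n) : KaehlerDifferential (𝒜 0) S →ₗ[S] S :=
    ((u⁻¹ : (𝒜 0)ˣ) : S) • φ ∘ₗ
      (exteriorPower.ιMulti S n).toMultilinearMap.toLinearMap (fun i => d (y i)) i
  have hψ : ∀ i ω, ψ i ω = ((u⁻¹ : (𝒜 0)ˣ) : S) *
      φ (exteriorPower.ιMulti S n (Function.update (fun i => d (y i)) i ω)) := fun _ _ => rfl
  let D (i : Fin n) : Derivation ℤ S S := ((ψ i).compDer d).restrictScalars ℤ
  have hD : ∀ i f, D i f = ψ i (d f) := fun _ _ => rfl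
  have h1 : ∀ i, derivationComponent 𝒜 (D i) (w i) (y i) = 1 := by
    intro i
    rw [derivationComponent_apply_of_mem 𝒜 _ _ (hy i), if_pos le_rfl, Nat.sub_self, hD, hψ,
      Function.update_eq_self, DirectSum.coe_decompose_mul_of_left_mem_zero (𝒜 := 𝒜) (SetLike.coe_mem _)]
    have := congrArg (fun t : 𝒜 0 => (t : S)) (u.inv_mul)
    rw [hu] at this
    exact this
  refine ⟨w, y, fun i => derivationComponent 𝒜 (D i) (w i), fun i => ?_, hy, h1, fun i j hij => ?_⟩
  · by_contra hw
    have hwi : w i = 0 := by omega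
    have h0 : d (y i) = 0 := d.map_algebraMap ⟨y i, hwi ▸ hy i⟩
    refine one_ne_zero ((h1 i).symm.trans (derivationComponent_apply_eq_zero 𝒜 _ (hy i) ?_))
    rw [hD, h0, map_zero]
  · refine derivationComponent_apply_eq_zero 𝒜 _ (hy j) ?_
    rw [hD, hψ, AlternatingMap.map_eq_zero_of_eq _ _ (i := i) (j := j), map_zero, mul_zero]
    · simp [Function.update_of_ne hij.symm]
    · exact hij

/-- The determinant of the matrix `D_i(f_j)` is a functional on `Ω^n` with the value `1` at
`dx_1 ∧ ⋯ ∧ dx_n`. -/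
theorem traceIdeal_eq_top_of_dual_derivations {R : Type v} [CommRing R] [Algebra R S] (n : ℕ)
    (x : Fin n → S) (D : Fin n → Derivation R S S)
    (hD : ∀ i j, D i (x j) = if i = j then 1 else 0) :
    traceIdeal S (⋀[S]^n (KaehlerDifferential R S)) = ⊤ := by
  let φ : ⋀[S]^n (KaehlerDifferential R S) →ₗ[S] S :=
    exteriorPower.alternatingMapLinearEquiv
      (Matrix.detRowAlternating.compLinearMap
        (LinearMap.pi fun i => (D i).liftKaehlerDifferential))
  rw [Ideal.eq_top_iff_one]
  convert apply_mem_traceIdeal φ (exteriorPower.ιMulti S n fun j => KaehlerDifferential.D R S (x j))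
  simp only [φ, exteriorPower.alternatingMapLinearEquiv_apply_ιMulti,
    AlternatingMap.compLinearMap_apply]
  rw [eq_comm, ← Matrix.det_one (n := Fin n)]
  change Matrix.det _ = _
  congr 1
  ext i j
  simp [hD, Matrix.one_apply, eq_comm]

end Trace

/-! ### Finiteness of the dimension -/

section Dimension

variable {S : Type u} [CommRing S] (𝒜 : ℕ → AddSubgroup S) [GradedRing 𝒜]

/-- A Noetherian `ℕ`-graded ring is generated over `S₀` by homogeneous generators of the ideal
`S_+`. -/
theorem finiteType_gradeZero [IsNoetherianRing S] : Algebra.FiniteType (𝒜 0) S := by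
  classical
  let H : Set S := {s | ∃ m, 0 < m ∧ s ∈ 𝒜 m}
  obtain ⟨F, hFH, hF⟩ := (Submodule.fg_span_iff_fg_span_finset_subset H).1
    (IsNoetherian.noetherian (Ideal.span H))
  refine ⟨F, ?_⟩
  have key : ∀ (m : ℕ) (s : S), s ∈ 𝒜 m → s ∈ Algebra.adjoin (𝒜 0) (F : Set S) := by
    intro m
    induction m using Nat.strong_induction_on with
    | _ m ih =>
      intro s hs
      rcases Nat.eq_zero_or_pos m with rfl | hm
      · exact Subalgebra.algebraMap_mem _ (⟨s, hs⟩ : 𝒜 0)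
      · have hsF : s ∈ Submodule.span S (F : Set S) := hF ▸ Ideal.subset_span ⟨m, hm, hs⟩
        rw [Submodule.mem_span_finset] at hsF
        obtain ⟨c, -, hc⟩ := hsF
        rw [← DirectSum.decompose_of_mem_same 𝒜 hs, ← hc, DirectSum.decompose_sum,
          DFinsupp.finsetSum_apply, AddSubmonoidClass.coe_finsetSum]
        refine sum_mem fun f hf => ?_
        obtain ⟨j, hj, hfj⟩ := hFH hf
        rw [smul_eq_mul, DirectSum.coe_decompose_mul_of_right_mem (𝒜 := 𝒜) _ hfj]
        split_ifs with hjm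
        · exact mul_mem (ih _ (by omega) _ (SetLike.coe_mem _)) (Algebra.subset_adjoin hf)
        · exact zero_mem _
  rw [eq_top_iff]
  intro s _
  induction s using DirectSum.Decomposition.inductionOn 𝒜 with
  | zero => exact zero_mem _
  | homogeneous a => exact key _ _ a.2
  | add a b ha hb => exact add_mem (ha trivial) (hb trivial)

theorem exists_natCast_eq_of_lt_top {x : WithBot ℕ∞} (h0 : 0 ≤ x) (h : x < ⊤) :
    ∃ n : ℕ, x = n := by
  induction x using WithBot.recBotCoe with
  | bot => exact absurd h0 (by simp)
  | coe x =>
    induction x using ENat.recTopCoe with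
    | top => exact absurd h (lt_irrefl _)
    | coe n => exact ⟨n, rfl⟩

theorem exists_ringKrullDim_eq_natCast [IsNoetherianRing S] [IsLocalRing (𝒜 0)] :
    ∃ d : ℕ, ringKrullDim S = d := by
  have : Nontrivial S := (𝒜 0).subtype_injective.nontrivial
  have := finiteType_gradeZero 𝒜
  obtain ⟨n, f, hf⟩ := Algebra.FiniteType.iff_quotient_mvPolynomial''.1 this
  have hle := ringKrullDim_le_of_surjective (f : MvPolynomial (Fin n) (𝒜 0) →+* S) hf
  rw [MvPolynomial.ringKrullDim_of_isNoetherianRing] at hle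
  obtain ⟨a, ha⟩ := exists_natCast_eq_of_lt_top (ringKrullDim_nonneg_of_nontrivial (R := 𝒜 0))
    ringKrullDim_lt_top
  rw [ha] at hle
  refine exists_natCast_eq_of_lt_top ringKrullDim_nonneg_of_nontrivial (hle.trans_lt ?_)
  rw [← Nat.cast_add]
  exact WithBot.coe_lt_coe.2 (ENat.natCast_lt_top (a + Nat.card (Fin n)))

theorem ringKrullDim_eq_zero_iff_of_equiv [IsNoetherianRing S] {A : Type v} [CommRing A] {n : ℕ}
    (e : S ≃+* MvPolynomial (Fin n) A) {d : ℕ} (hd : ringKrullDim S = d) :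
    ringKrullDim A = 0 ↔ n = d := by
  have hsurj : Function.Surjective (MvPolynomial.constantCoeff (R := A) (σ := Fin n)) :=
    fun a => ⟨MvPolynomial.C a, by simp⟩
  have : IsNoetherianRing A := isNoetherianRing_of_surjective S A
    ((MvPolynomial.constantCoeff (R := A) (σ := Fin n)).comp (e : S →+* _))
    (hsurj.comp e.surjective)
  have h := ringKrullDim_eq_of_ringEquiv e
  rw [MvPolynomial.ringKrullDim_of_isNoetherianRing, hd, Nat.card_eq_fintype_card,
    Fintype.card_fin] at h
  constructor
  · intro h0
    rw [h0, zero_add] at h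
    exact_mod_cast h.symm
  · rintro rfl
    generalize ringKrullDim A = x at h
    induction x using WithBot.recBotCoe with
    | bot => exact absurd h (by simp)
    | coe x =>
      induction x using ENat.recTopCoe with
      | top => exact absurd (WithBot.coe_injective h) (by simp)
      | coe a =>
        have : n = a + n := by exact_mod_cast h
        obtain rfl : a = 0 := by omega
        rfl

end Dimension

/-! ### Graded polynomial extensions and their derivations -/

section Extension

variable {S : Type u} [CommRing S] (𝒜 : ℕ → AddSubgroup S) [GradedRing 𝒜]

/-- In positive weights, polynomials of degree zero are constant. -/
theorem eq_C_of_mem_polynomialGrading_zero {A : Type v} [CommRing A] {σ : Type*} [SetLike σ A]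
    [AddSubgroupClass σ A] {ℬ : ℕ → σ} {n : ℕ} {w : Fin n → ℕ} (hw : ∀ i, 0 < w i)
    {p : MvPolynomial (Fin n) A} (hp : p ∈ polynomialGrading ℬ w 0) :
    p = MvPolynomial.C (MvPolynomial.constantCoeff p) ∧ MvPolynomial.constantCoeff p ∈ ℬ 0 := by
  constructor
  · ext e
    rw [MvPolynomial.coeff_C]
    split_ifs with he
    · rw [← he, MvPolynomial.constantCoeff_eq]
    · by_contra hne
      have := Finsupp.nonTorsionWeight_of ℕ (w := w) fun i => (hw i).ne'
      obtain ⟨j, hj, -⟩ := hp e hne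
      have h0 : Finsupp.weight w e = 0 := by omega
      rw [Finsupp.weight_eq_zero_iff_eq_zero] at h0
      exact he h0.symm
  · rw [MvPolynomial.constantCoeff_eq]
    by_cases h : p.coeff 0 = 0
    · rw [h]; exact zero_mem _
    · obtain ⟨j, hj, hpj⟩ := hp 0 h
      obtain rfl : j = 0 := by omega
      exact hpj

/-- The partial derivatives of a graded polynomial extension are linear over `S₀`, which consists
of constants as the variables have positive degrees. -/
theorem traceIdeal_eq_top_of_equiv {A : Type v} [CommRing A] {σ : Type*} [SetLike σ A]
    [AddSubgroupClass σ A] {ℬ : ℕ → σ} {n : ℕ} {w : Fin n → ℕ} (hw : ∀ i, 0 < w i)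
    (e : S ≃+* MvPolynomial (Fin n) A)
    (he : ∀ (m : ℕ) (s : S), e s ∈ polynomialGrading ℬ w m ↔ s ∈ 𝒜 m) {k : ℕ} (hk : k ≤ n) :
    traceIdeal S (GradedDifferentials 𝒜 k) = ⊤ := by
  have hconst : ∀ (i : Fin n) (r : 𝒜 0), MvPolynomial.pderiv i (e (r : S)) = 0 := by
    intro i r
    rw [(eq_C_of_mem_polynomialGrading_zero hw ((he 0 r).2 r.2)).1, MvPolynomial.pderiv_C]
  let D (i : Fin n) : Derivation (𝒜 0) S S := Derivation.mk'
    { toFun := fun s => e.symm (MvPolynomial.pderiv i (e s))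
      map_add' := fun s t => by simp
      map_smul' := fun r s => by
        rw [Algebra.smul_def, SetLike.GradeZero.algebraMap_apply, map_mul,
          MvPolynomial.pderiv_mul, hconst]
        simp [Algebra.smul_def] }
    fun s t => by
      simp
  refine traceIdeal_eq_top_of_dual_derivations k
    (fun j => e.symm (MvPolynomial.X (Fin.castLE hk j))) (fun i => D (Fin.castLE hk i)) ?_
  intro i j
  change e.symm (MvPolynomial.pderiv _ (e (e.symm _))) = _
  rw [RingEquiv.apply_symm_apply, MvPolynomial.pderiv_X, Pi.single_apply]
  simp only [Fin.castLE_inj, eq_comm (a := j)]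
  split_ifs <;> simp

theorem isPolynomialExtension_of_traceIdeal_eq_top [Algebra ℚ S] [IsLocalRing (𝒜 0)] {n : ℕ}
    (h : traceIdeal S (GradedDifferentials 𝒜 n) = ⊤) : IsPolynomialExtension 𝒜 n := by
  obtain ⟨w, x, D, hw, hx, h1, h0⟩ := exists_dual_derivations_of_traceIdeal_eq_top 𝒜 n h
  have hS : ∀ n : ℕ, n ≠ 0 → IsUnit (n : S) := fun n hn => by
    have := (IsUnit.mk0 (n : ℚ) (by exact_mod_cast hn)).map (algebraMap ℚ S)
    rwa [map_natCast] at this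
  obtain ⟨T, hT, hb⟩ := exists_subring_bijective_eval₂Hom n 𝒜 hS w hw x hx D h1 h0
  refine ⟨T, hT, w, hw, (RingEquiv.ofBijective _ hb).symm, fun m s => ?_⟩
  rw [mem_polynomialGrading_iff 𝒜 hT hx hb.1]
  exact iff_of_eq (congrArg (· ∈ 𝒜 m) ((RingEquiv.ofBijective _ hb).apply_symm_apply s))

theorem le_polynomialRank_iff [Algebra ℚ S] [IsLocalRing (𝒜 0)] (n : ℕ) :
    (n : ℕ∞) ≤ polynomialRank 𝒜 ↔ traceIdeal S (GradedDifferentials 𝒜 n) = ⊤ := by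
  constructor
  · intro h
    rcases n with _ | n
    · exact traceIdeal_eq_top_of_dual_derivations 0 Fin.elim0 Fin.elim0 fun i => i.elim0
    · have hlt : (n : ℕ∞) < polynomialRank 𝒜 :=
        lt_of_lt_of_le (by exact_mod_cast Nat.lt_succ_self n) h
      simp only [polynomialRank, lt_iSup_iff] at hlt
      obtain ⟨m, ⟨T, hT, w, hw, e, he⟩, hm⟩ := hlt
      exact traceIdeal_eq_top_of_equiv 𝒜 hw e he (by exact_mod_cast hm)
  · intro h
    exact le_iSup₂_of_le n (isPolynomialExtension_of_traceIdeal_eq_top 𝒜 h) le_rfl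

theorem isPolynomialOverDimZero_iff_traceIdeal_eq_top [IsNoetherianRing S] [Algebra ℚ S]
    [IsLocalRing (𝒜 0)] {d : ℕ} (hd : ringKrullDim S = d) :
    IsPolynomialOverDimZero 𝒜 ↔ traceIdeal S (GradedDifferentials 𝒜 d) = ⊤ := by
  constructor
  · rintro ⟨A, _, ℬ, _, hA, n, w, hw, e, he⟩
    exact traceIdeal_eq_top_of_equiv 𝒜 hw e he
      ((ringKrullDim_eq_zero_iff_of_equiv e hd).1 hA).ge
  · intro h
    obtain ⟨T, hT, w, hw, e, he⟩ := isPolynomialExtension_of_traceIdeal_eq_top 𝒜 h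
    exact ⟨T, inferInstance, subringGrading 𝒜 T, subringGradedRing 𝒜 hT,
      (ringKrullDim_eq_zero_iff_of_equiv e hd).2 rfl, d, w, hw, e, he⟩

/-- A graded isomorphism `S ≃ A[x_1, …, x_n]` with variables of positive degrees makes `A` an
`S₀`-algebra, because it maps `S₀` into `A₀`. -/
theorem isPolynomialOverDimZeroAlgebra_iff :
    IsPolynomialOverDimZeroAlgebra 𝒜 ↔ IsPolynomialOverDimZero 𝒜 := by
  constructor
  · rintro ⟨A, _, _, ℬ, _, hA, n, w, hw, e, he⟩
    refine ⟨A, inferInstance, fun i => (ℬ i).toAddSubgroup,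
      { one_mem := SetLike.GradedOne.one_mem (A := ℬ)
        mul_mem := fun _ _ _ _ ha hb => SetLike.GradedMul.mul_mem (A := ℬ) ha hb
        decompose' := DirectSum.Decomposition.decompose' (ℳ := ℬ)
        left_inv := DirectSum.Decomposition.left_inv (ℳ := ℬ)
        right_inv := DirectSum.Decomposition.right_inv (ℳ := ℬ) },
      hA, n, w, hw, e.toRingEquiv, he⟩
  · rintro ⟨A, _, ℬ, _, hA, n, w, hw, e, he⟩
    let ρ : 𝒜 0 →+* A := (MvPolynomial.constantCoeff (R := A) (σ := Fin n)).comp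
      ((e : S →+* _).comp (algebraMap (𝒜 0) S))
    have hρ : ∀ r : 𝒜 0, e (r : S) = MvPolynomial.C (ρ r) := fun r =>
      (eq_C_of_mem_polynomialGrading_zero hw ((he 0 r).2 r.2)).1
    have hρ0 : ∀ r : 𝒜 0, ρ r ∈ ℬ 0 := fun r =>
      (eq_C_of_mem_polynomialGrading_zero hw ((he 0 r).2 r.2)).2
    let _ : Algebra (𝒜 0) A := ρ.toAlgebra
    let ℬ' : ℕ → Submodule (𝒜 0) A := fun i =>
      { (ℬ i) with
        smul_mem' := fun r a ha => by
          have := SetLike.GradedMul.mul_mem (A := ℬ) (hρ0 r) ha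
          rwa [zero_add] at this }
    refine ⟨A, inferInstance, inferInstance, ℬ',
      { one_mem := SetLike.GradedOne.one_mem (A := ℬ)
        mul_mem := fun _ _ _ _ ha hb => SetLike.GradedMul.mul_mem (A := ℬ) ha hb
        decompose' := DirectSum.Decomposition.decompose' (ℳ := ℬ)
        left_inv := DirectSum.Decomposition.left_inv (ℳ := ℬ)
        right_inv := DirectSum.Decomposition.right_inv (ℳ := ℬ) },
      hA, n, w, hw, AlgEquiv.ofRingEquiv (f := e) hρ, he⟩

end Extension

theorem corollary3p10 {S : Type u} [CommRing S] [IsNoetherianRing S] [Algebra ℚ S]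
    (𝒜 : ℕ → AddSubgroup S) [GradedRing 𝒜] [IsLocalRing (𝒜 0)] :
    ∃ d : ℕ, ringKrullDim S = d ∧
      (∀ k : ℕ, k ≤ d →
        (((d - k : ℕ) : ℕ∞) ≤ polynomialRank 𝒜 ↔
          traceIdeal S (GradedDifferentials 𝒜 (d - k)) = ⊤)) ∧
      (IsPolynomialOverDimZero 𝒜 ↔ traceIdeal S (GradedDifferentials 𝒜 d) = ⊤) ∧
      (IsPolynomialOverDimZeroAlgebra 𝒜 ↔ traceIdeal S (GradedDifferentials 𝒜 d) = ⊤) := by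
  obtain ⟨d, hd⟩ := exists_ringKrullDim_eq_natCast 𝒜
  have h := isPolynomialOverDimZero_iff_traceIdeal_eq_top 𝒜 hd
  exact ⟨d, hd, fun k _ => le_polynomialRank_iff 𝒜 (d - k), h,
    (isPolynomialOverDimZeroAlgebra_iff 𝒜).trans h⟩
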